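/- For $N\ge 1$ let $P_N^Q$ be the law of the eigenvalues $(z_1,\dots,z_N)\in\mathbb C^N$ of Ginibre's Gaussian quaternion ensemble, that is, the probability measure on $\mathbb C^N$ given by $$dP_N^Q(z_1,\dots,z_N)=\frac1{Z_N^Q}\prod_{1\le \ell<k\le N}|z_\ell-z_k|^2\,|z_\ell-\bar z_k|^2\prod_{k=1}^N|z_k-\bar z_k|^2\prod_{k=1}^N e^{-2N|z_k|^2}\,d\Re(z_k)\,d\Im(z_k),$$ where $Z_N^Q\in(0,\infty)$ is the normalizing constant. For $0\le a\le b$ let $\#\mathcal I[a,b]=\#\{k : a\le |z_k|\le b\}$ be the radial number statistic. Let $[a_N,b_N]\subset[0,1]$ be intervals, possibly depending on $N$, such that $b_N$ stays bounded away from $0$ (that is, for some $\varepsilon>0$ one has $0\le a_N$ and $\varepsilon\le b_N\le 1$ for all large $N$), and suppose that $N(b_N-a_N)\to\infty$ as $N\to\infty$. Then, with mean and variance taken under $P_N^Q$, $$\frac{\#\mathcal I[a_N,b_N]-E[\#\mathcal I[a_N,b_N]]}{\sqrt{\mathrm{Var}(\#\mathcal I[a_N,b_N])}}$$ converges in distribution,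 as $N\to\infty$, to a Gaussian random variable of mean zero and variance one. -/

import Mathlib

open MeasureTheory ProbabilityTheory Filter Topology

namespace QuaternionGinibre

/-- The unnormalized joint eigenvalue density, with respect to Lebesgue measure on `ℂ ^ N`,
`∏_{l < k} |z_l - z_k|² |z_l - conj z_k|² · ∏_k |z_k - conj z_k|² · ∏_k exp (-2 N |z_k|²)`. -/
noncomputable def weight (N : ℕ) (z : Fin N → ℂ) : ℝ :=
  (∏ k, ∏ l ∈ Finset.Iio k,
      ‖z l - z k‖ ^ 2 * ‖z l - (starRingEnd ℂ) (z k)‖ ^ 2) *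
    (∏ k, ‖z k - (starRingEnd ℂ) (z k)‖ ^ 2) *
    ∏ k, Real.exp (-2 * (N : ℝ) * ‖z k‖ ^ 2)

/-- The normalizing constant. -/
noncomputable def partitionFunction (N : ℕ) : ENNReal :=
  ∫⁻ z : Fin N → ℂ, ENNReal.ofReal (weight N z)

/-- The eigenvalue law of the quaternion Gaussian ensemble: the probability measure on `ℂ ^ N`
whose density with respect to Lebesgue measure is proportional to `weight N`. -/
noncomputable def law (N : ℕ) : Measure (Fin N → ℂ) :=
  (partitionFunction N)⁻¹ •
    (volume : Measure (Fin N → ℂ)).withDensity (fun z => ENNReal.ofReal (weight N z))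

/-- The linear statistic `X(f) = ∑_k f (z_k)`. -/
noncomputable def linearStatistic {N : ℕ} (f : ℂ → ℝ) (z : Fin N → ℂ) : ℝ :=
  ∑ k, f (z k)

/-- The radial number statistic: the number of indices `k` with `a ≤ |z_k| ≤ b`. -/
noncomputable def radialCount {N : ℕ} (a b : ℝ) (z : Fin N → ℂ) : ℝ :=
  linearStatistic (Set.indicator {w : ℂ | ‖w‖ ∈ Set.Icc a b} 1) z

/-- The normalized radial number statistic `(#I - E #I) / √(Var #I)`. -/
noncomputable def normalizedRadialCount (N : ℕ) (a b : ℝ) (z : Fin N → ℂ) : ℝ :=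
  (radialCount a b z - ∫ y, radialCount a b y ∂(law N)) /
    Real.sqrt (variance (radialCount a b) (law N))

theorem continuous_weight (N : ℕ) : Continuous (weight N) := by
  unfold weight
  fun_prop

theorem weight_nonneg (N : ℕ) (z : Fin N → ℂ) : 0 ≤ weight N z := by
  unfold weight
  positivity

theorem integrable_factor (M : ℕ) {c : ℝ} (hc : 0 < c) :
    Integrable (fun z : ℂ => (1 + ‖z‖) ^ M * Real.exp (-c * ‖z‖ ^ 2)) := by
  have hg : Integrable (fun z : ℂ => Real.exp (-(c / 2) * ‖z‖ ^ 2)) := by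
    have h := (GaussianFourier.integrable_cexp_neg_mul_sq_norm_add (V := ℂ)
      (b := ((c / 2 : ℝ) : ℂ)) (by simpa using hc) 0 0).norm
    refine h.congr (Eventually.of_forall fun z => ?_)
    simp only [Complex.norm_exp]
    congr 1
    norm_cast
    simp
  refine (hg.const_mul (M.factorial * Real.exp (1 + 1 / (2 * c)))).mono'
    (by fun_prop) (Eventually.of_forall fun z => ?_)
  have h1 := Real.pow_div_factorial_le_exp (1 + ‖z‖) (by positivity) M
  have hf : (0 : ℝ) < M.factorial := by positivity
  rw [div_le_iff₀ hf] at h1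
  rw [Real.norm_of_nonneg (by positivity)]
  have h2 : 1 + ‖z‖ - c * ‖z‖ ^ 2 ≤ 1 + 1 / (2 * c) - c / 2 * ‖z‖ ^ 2 := by
    have : 1 / (2 * c) - ‖z‖ + c / 2 * ‖z‖ ^ 2 = (c * ‖z‖ - 1) ^ 2 / (2 * c) := by
      field_simp
      ring
    have : 0 ≤ (c * ‖z‖ - 1) ^ 2 / (2 * c) := by positivity
    linarith
  calc (1 + ‖z‖) ^ M * Real.exp (-c * ‖z‖ ^ 2)
      ≤ (Real.exp (1 + ‖z‖) * M.factorial) * Real.exp (-c * ‖z‖ ^ 2) := by gcongr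
    _ = M.factorial * Real.exp (1 + ‖z‖ - c * ‖z‖ ^ 2) := by
        rw [show 1 + ‖z‖ - c * ‖z‖ ^ 2 = (1 + ‖z‖) + (-c * ‖z‖ ^ 2) by ring,
          Real.exp_add (1 + ‖z‖)]
        ring
    _ ≤ M.factorial * Real.exp (1 + 1 / (2 * c) - c / 2 * ‖z‖ ^ 2) := by gcongr
    _ = M.factorial * Real.exp (1 + 1 / (2 * c)) * Real.exp (-(c / 2) * ‖z‖ ^ 2) := by
        rw [show 1 + 1 / (2 * c) - c / 2 * ‖z‖ ^ 2
          = (1 + 1 / (2 * c)) + (-(c / 2) * ‖z‖ ^ 2) by ring, Real.exp_add]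
        ring

theorem integrable_weight (N : ℕ) : Integrable (weight N) := by
  obtain ⟨M, hM⟩ : ∃ M : ℕ, ∀ z : Fin N → ℂ,
      (∏ k, ∏ l ∈ Finset.Iio k, ‖z l - z k‖ ^ 2 * ‖z l - (starRingEnd ℂ) (z k)‖ ^ 2) *
        (∏ k, ‖z k - (starRingEnd ℂ) (z k)‖ ^ 2) ≤ (∏ k, (1 + ‖z k‖)) ^ M := by
    refine ⟨(∑ k : Fin N, ∑ _l ∈ Finset.Iio k, 8) + ∑ _k : Fin N, 4, fun z => ?_⟩
    set S : ℝ := ∏ k, (1 + ‖z k‖) with hS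
    have h1 : ∀ k, 1 + ‖z k‖ ≤ S := fun k => by
      rw [hS, ← Finset.mul_prod_erase _ _ (Finset.mem_univ k)]
      refine le_mul_of_one_le_right (by positivity) ?_
      calc (1 : ℝ) = ∏ _j ∈ Finset.univ.erase k, (1 : ℝ) := by simp
        _ ≤ _ := Finset.prod_le_prod (fun _ _ => zero_le_one) (fun i _ => by simp)
    have hd : ∀ k l, ‖z l - z k‖ ≤ S ^ 2 := fun k l => by
      have := norm_sub_le (z l) (z k)
      nlinarith [h1 k, h1 l, norm_nonneg (z k), norm_nonneg (z l)]
    have hd' : ∀ k l, ‖z l - (starRingEnd ℂ) (z k)‖ ≤ S ^ 2 := fun k l => by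
      have := norm_sub_le (z l) ((starRingEnd ℂ) (z k))
      rw [RCLike.norm_conj] at this
      nlinarith [h1 k, h1 l, norm_nonneg (z k), norm_nonneg (z l)]
    rw [pow_add]
    simp only [← Finset.prod_pow_eq_pow_sum]
    gcongr with k _ l _ k _
    · calc ‖z l - z k‖ ^ 2 * ‖z l - (starRingEnd ℂ) (z k)‖ ^ 2
          ≤ (S ^ 2) ^ 2 * (S ^ 2) ^ 2 := by gcongr <;> simp [hd, hd']
        _ = S ^ 8 := by ring
    · calc ‖z k - (starRingEnd ℂ) (z k)‖ ^ 2 ≤ (S ^ 2) ^ 2 := by gcongr; exact hd' k k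
        _ = S ^ 4 := by ring
  rcases Nat.eq_zero_or_pos N with rfl | hN
  · simp [Integrable.of_finite]
  have hc : (0 : ℝ) < 2 * N := by positivity
  refine (Integrable.fintype_prod (μ := fun _ => volume)
    (fun _ : Fin N => integrable_factor M hc)).mono'
    (continuous_weight N).aestronglyMeasurable (Eventually.of_forall fun z => ?_)
  rw [Real.norm_of_nonneg (weight_nonneg N z), Finset.prod_mul_distrib, Finset.prod_pow]
  unfold weight
  simp only [← neg_mul]
  gcongr
  exact hM z

theorem partitionFunction_ne_top (N : ℕ) : partitionFunction N ≠ ⊤ :=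
  (integrable_weight N).lintegral_lt_top.ne

theorem partitionFunction_ne_zero (N : ℕ) : partitionFunction N ≠ 0 := by
  intro h
  have hcont : Continuous (fun z : Fin N → ℂ => ENNReal.ofReal (weight N z)) :=
    ENNReal.continuous_ofReal.comp (continuous_weight N)
  rw [partitionFunction, lintegral_eq_zero_iff hcont.measurable] at h
  have h0 := (Continuous.ae_eq_iff_eq (μ := volume) hcont continuous_zero).1 h
  have h1 := congrFun h0 (fun k : Fin N => (((k : ℕ) + 1 : ℝ) : ℂ) * Complex.I)
  simp only [Pi.zero_apply, ENNReal.ofReal_eq_zero] at h1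
  refine absurd h1 (not_le.2 ?_)
  unfold weight
  have hp : ∀ k l : Fin N, (((l : ℕ) + 1 : ℝ) : ℂ) * Complex.I
      - (starRingEnd ℂ) ((((k : ℕ) + 1 : ℝ) : ℂ) * Complex.I) ≠ 0 := by
    intro k l hkl
    have := congrArg Complex.im hkl
    simp at this
    have hk : (0 : ℝ) ≤ (k : ℕ) := by positivity
    have hl : (0 : ℝ) ≤ (l : ℕ) := by positivity
    linarith
  refine mul_pos (mul_pos ?_ ?_) (by positivity)
  · refine Finset.prod_pos fun k _ => Finset.prod_pos fun l hl => ?_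
    have hlk : (l : ℕ) < k := Fin.lt_def.1 (Finset.mem_Iio.1 hl)
    have h2 : (((l : ℕ) + 1 : ℝ) : ℂ) * Complex.I - (((k : ℕ) + 1 : ℝ) : ℂ) * Complex.I ≠ 0 := by
      intro hkl
      have := congrArg Complex.im hkl
      simp [sub_eq_zero] at this
      omega
    exact mul_pos (pow_pos (norm_pos_iff.2 h2) 2) (pow_pos (norm_pos_iff.2 (hp k l)) 2)
  · exact Finset.prod_pos fun k _ => pow_pos (norm_pos_iff.2 (hp k k)) 2

instance isProbabilityMeasure_law (N : ℕ) : IsProbabilityMeasure (law N) := by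
  constructor
  rw [law, Measure.smul_apply, withDensity_apply _ MeasurableSet.univ, Measure.restrict_univ,
    smul_eq_mul]
  exact ENNReal.inv_mul_cancel (partitionFunction_ne_zero N) (partitionFunction_ne_top N)

end QuaternionGinibre

/-! The weight is a Vandermonde determinant in the `2 * N` points `z_k`, `conj z_k`, times
one-particle factors `(z_k - conj z_k) exp (-2 N |z_k|²)`. Multiply it by a radial product `∏ h
|z_k|`, expand the determinant over permutations and integrate each variable separately. Rotation
invariance kills every one-particle integral unless its two exponents are consecutive. The exponents
`0, …, 2 N - 1` must then be paired as `{2 j, 2 j + 1}`, because a path has only one perfect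
matching. Every surviving term is thus a constant times the same product of moments of order `2 j +
1` (`exists_integral_weight_mul_prod`).

Normalizing with `h = 1` shows that, for symmetric radial products, the `2 N |z_k|²` behave like
independent Gamma variables of shapes `2 j + 2`. With `h = exp (i t 1_[a,b])` this makes the count a
sum of independent Bernoulli variables (`map_radialCount`), of parameters `p_j = P(Gamma_{2j+2} ∈ [2
N a², 2 N b²])`.

It remains to see that `V = ∑ p_j (1 - p_j)` diverges (`tendsto_sum_bernoulliParam`). With `B = 2 N
b²`, about `√B` of the shapes lie within `√B` below `B`, and Stirling's formula bounds their Gamma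
densities near `B` from below by a multiple of `1 / √B`. A Taylor expansion of the characteristic
functions, with error at most `2 |t|³ / √V`, then gives the Gaussian limit. -/

namespace QuaternionGinibre

/-! ### The density as a determinant. -/

/-- The `2 N` points `z_k`, `conj z_k`. -/
noncomputable def conjPair {N : ℕ} (z : Fin N → ℂ) (i : Fin N × Fin 2) : ℂ :=
  if i.2 = 0 then z i.1 else (starRingEnd ℂ) (z i.1)

/-- The exponent attached to a column of the Vandermonde matrix of the points `conjPair z`. -/
def expo {N : ℕ} (i : Fin N × Fin 2) : ℕ := i.2 + 2 * i.1

theorem expo_eq {N : ℕ} (i : Fin N × Fin 2) : expo i = (finProdFinEquiv i : ℕ) := rfl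

theorem expo_injective {N : ℕ} : Function.Injective (expo (N := N)) := fun _ _ h =>
  finProdFinEquiv.injective (Fin.ext h)

theorem prod_Iio_swap {N : ℕ} {M : Type*} [CommMonoid M] (f : Fin N → Fin N → M) :
    ∏ i, ∏ j ∈ Finset.Ioi i, f i j = ∏ j, ∏ i ∈ Finset.Iio j, f i j :=
  Finset.prod_comm' (by simp)

/-- The Vandermonde determinant of the points `z_1, conj z_1, …, z_N, conj z_N`. -/
theorem det_conjPair {N : ℕ} (z : Fin N → ℂ) :
    (Matrix.of fun i j : Fin N × Fin 2 => conjPair z i ^ expo j).det =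
      (∏ k, ((starRingEnd ℂ) (z k) - z k)) *
        ∏ k, ∏ l ∈ Finset.Iio k,
          ((‖z l - z k‖ ^ 2 * ‖z l - (starRingEnd ℂ) (z k)‖ ^ 2 : ℝ) : ℂ) := by
  have h1 : (Matrix.of fun i j : Fin N × Fin 2 => conjPair z i ^ expo j) =
      (Matrix.vandermonde (conjPair z ∘ finProdFinEquiv.symm)).submatrix finProdFinEquiv
        finProdFinEquiv := by
    ext i j
    simp [Matrix.vandermonde_apply, expo_eq]
  rw [h1, Matrix.det_submatrix_equiv_self, Matrix.det_vandermonde]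
  -- Writing the order constraint as an `if` lets both products be reindexed over pairs `(k, e)`.
  have h2 : ∀ i : Fin (N * 2), ∏ j ∈ Finset.Ioi i, ((conjPair z ∘ finProdFinEquiv.symm) j -
      (conjPair z ∘ finProdFinEquiv.symm) i) = ∏ j : Fin (N * 2), if i < j then
        ((conjPair z ∘ finProdFinEquiv.symm) j - (conjPair z ∘ finProdFinEquiv.symm) i) else 1 := by
    intro i
    rw [Finset.prod_ite]
    simp [Finset.filter_lt_eq_Ioi]
  simp_rw [h2]
  rw [← finProdFinEquiv.prod_comp]
  simp_rw [← (finProdFinEquiv (m := N) (n := 2)).prod_comp]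
  simp only [Function.comp_apply, Equiv.symm_apply_apply, Fin.lt_def, ← expo_eq,
    Fintype.prod_prod_type, Fin.prod_univ_two]
  simp only [expo, conjPair, Fin.isValue, Fin.val_zero, Fin.val_one, if_true, one_ne_zero,
    if_false, zero_add]
  simp_rw [← Finset.prod_mul_distrib]
  -- The four differences between the blocks of `k < l` group into two squared moduli; a diagonal
  -- block leaves only `conj z_k - z_k`.
  have h3 : ∀ k l : Fin N,
      ((if 2 * (k : ℕ) < 2 * l then z l - z k else 1) *
        (if 2 * (k : ℕ) < 1 + 2 * l then (starRingEnd ℂ) (z l) - z k else 1)) *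
      ((if 1 + 2 * (k : ℕ) < 2 * l then z l - (starRingEnd ℂ) (z k) else 1) *
        (if 1 + 2 * (k : ℕ) < 1 + 2 * l then
          (starRingEnd ℂ) (z l) - (starRingEnd ℂ) (z k) else 1)) =
      (if k = l then (starRingEnd ℂ) (z k) - z k else 1) *
        (if k < l then ((‖z k - z l‖ ^ 2 * ‖z k - (starRingEnd ℂ) (z l)‖ ^ 2 : ℝ) : ℂ)
          else 1) := by
    intro k l
    rcases lt_trichotomy k l with h | h | h
    · have h' : (k : ℕ) < l := h
      rw [if_pos (by omega), if_pos (by omega), if_pos (by omega), if_pos (by omega),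
        if_neg h.ne, if_pos h]
      push_cast
      rw [← Complex.mul_conj', ← Complex.mul_conj']
      simp only [map_sub, Complex.conj_conj]
      ring
    · subst h
      simp
    · have h' : (l : ℕ) < k := h
      rw [if_neg (by omega), if_neg (by omega), if_neg (by omega), if_neg (by omega),
        if_neg h.ne', if_neg h.not_gt]
      simp
  simp_rw [h3, Finset.prod_mul_distrib]
  congr 1
  · simp
  · rw [← prod_Iio_swap fun l k => ((‖z l - z k‖ ^ 2 * ‖z l - (starRingEnd ℂ) (z k)‖ ^ 2 : ℝ) : ℂ)]
    refine Finset.prod_congr rfl fun k _ => ?_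
    rw [Finset.prod_ite]
    simp [Finset.filter_lt_eq_Ioi]

/-- The factor `|z_k - conj z_k|²` is `(conj z_k - z_k) (z_k - conj z_k)`: the first half belongs to
the Vandermonde determinant, the second stays with the one-particle weight and produces the skew
moments. -/
theorem weight_eq_det (N : ℕ) (z : Fin N → ℂ) :
    ((weight N z : ℝ) : ℂ) =
      (Matrix.of fun i j : Fin N × Fin 2 => conjPair z i ^ expo j).det *
        ∏ k, ((z k - (starRingEnd ℂ) (z k)) * (Real.exp (-(2 * N) * ‖z k‖ ^ 2) : ℂ)) := by
  have h : ∀ k, ((‖z k - (starRingEnd ℂ) (z k)‖ ^ 2 : ℝ) : ℂ) =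
      ((starRingEnd ℂ) (z k) - z k) * (z k - (starRingEnd ℂ) (z k)) := by
    intro k
    push_cast
    rw [← Complex.mul_conj']
    simp only [map_sub, Complex.conj_conj]
    ring
  rw [det_conjPair, weight, Finset.prod_mul_distrib]
  push_cast [← neg_mul]
  simp only [← Complex.ofReal_pow, h, Finset.prod_mul_distrib]
  push_cast
  ring

/-! ### Permutations that survive integration. -/

/-- A permutation whose values on each pair `(k, 0)`, `(k, 1)` have consecutive exponents
maps each of these pairs onto such a pair. -/
theorem fst_perm_eq {N : ℕ} (σ : Equiv.Perm (Fin N × Fin 2))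
    (h : ∀ k, expo (σ (k, 1)) = expo (σ (k, 0)) + 1 ∨ expo (σ (k, 0)) = expo (σ (k, 1)) + 1)
    (k : Fin N) : (σ (k, 0)).1 = (σ (k, 1)).1 := by
  have hinj : ∀ i j : Fin N × Fin 2, expo (σ i) = expo (σ j) → i = j := fun i j hij =>
    σ.injective (expo_injective hij)
  -- an even value and its successor always come from the same pair
  have key : ∀ v : ℕ, ∀ i j : Fin N × Fin 2, expo (σ i) = 2 * v → expo (σ j) = 2 * v + 1 →
      i.1 = j.1 := by
    -- Unique perfect matching of a path: `0` can only be matched with `1`, and once `2 v` is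
    -- matched with `2 v + 1`, the only partner left for `2 v + 2` is `2 v + 3`.
    intro v
    induction v with
    | zero =>
      rintro ⟨k, e⟩ j hi hj
      have hk := h k
      fin_cases e
      · have hi' : expo (σ (k, 0)) = 0 := hi
        have : expo (σ (k, 1)) = expo (σ j) := by omega
        rw [← hinj _ _ this]
      · have hi' : expo (σ (k, 1)) = 0 := hi
        have : expo (σ (k, 0)) = expo (σ j) := by omega
        rw [← hinj _ _ this]
    | succ v ih =>
      rintro ⟨k, e⟩ j hi hj
      have hlt : ∀ x : Fin N × Fin 2, expo x < N * 2 := fun x => by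
        rw [expo_eq]; exact (finProdFinEquiv x).2
      -- the index carrying the value `2 v`
      obtain ⟨i', hi'⟩ : ∃ i', expo (σ i') = 2 * v := by
        have : 2 * v < N * 2 := by
          have := hlt (σ (k, e)); omega
        refine ⟨σ.symm (finProdFinEquiv.symm ⟨2 * v, this⟩), ?_⟩
        rw [Equiv.apply_symm_apply, expo_eq, Equiv.apply_symm_apply]
      have hk := h k
      fin_cases e
      · have hi₁ : expo (σ (k, 0)) = 2 * (v + 1) := hi
        rcases hk with hk | hk
        · have : expo (σ (k, 1)) = expo (σ j) := by omega
          rw [← hinj _ _ this]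
        -- If the partner had the value `2 v + 1`, induction would put `2 v` in the same pair, so
        -- two indices would carry three values.
        · have h1 : expo (σ (k, 1)) = 2 * v + 1 := by omega
          have h2 := ih i' (k, 1) hi' h1
          obtain ⟨k', e'⟩ := i'
          simp only at h2
          subst h2
          exfalso
          fin_cases e'
          · have : expo (σ (k', 0)) = 2 * v := hi'
            omega
          · have : expo (σ (k', 1)) = 2 * v := hi'
            omega
      · have hi₁ : expo (σ (k, 1)) = 2 * (v + 1) := hi
        rcases hk with hk | hk
        · have h1 : expo (σ (k, 0)) = 2 * v + 1 := by omega
          have h2 := ih i' (k, 0) hi' h1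
          obtain ⟨k', e'⟩ := i'
          simp only at h2
          subst h2
          exfalso
          fin_cases e'
          · have : expo (σ (k', 0)) = 2 * v := hi'
            omega
          · have : expo (σ (k', 1)) = 2 * v := hi'
            omega
        · have : expo (σ (k, 0)) = expo (σ j) := by omega
          rw [← hinj _ _ this]
  by_contra hne
  have hk := h k
  have hne' : ((σ (k, 0)).1 : ℕ) ≠ (σ (k, 1)).1 := fun h => hne (Fin.ext h)
  have b0 := (σ (k, 0)).2.2
  have b1 := (σ (k, 1)).2.2
  have e0 : expo (σ (k, 0)) = (σ (k, 0)).2 + 2 * (σ (k, 0)).1 := rfl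
  have e1 : expo (σ (k, 1)) = (σ (k, 1)).2 + 2 * (σ (k, 1)).1 := rfl
  -- the smaller value is odd, so its even predecessor comes from the same pair
  rcases hk with hk | hk
  · have e0' : expo (σ (k, 0)) = 2 * (σ (k, 0)).1 + 1 := by omega
    have hv : expo (σ (σ.symm ((σ (k, 0)).1, 0))) = 2 * (σ (k, 0)).1 := by
      rw [Equiv.apply_symm_apply]; simp [expo]
    have := key _ _ _ hv e0'
    generalize σ.symm ((σ (k, 0)).1, 0) = x at hv this
    obtain ⟨k', e'⟩ := x
    simp only at this
    subst this
    fin_cases e'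
    · have : expo (σ (k', 0)) = 2 * (σ (k', 0)).1 := hv
      omega
    · have : expo (σ (k', 1)) = 2 * (σ (k', 0)).1 := hv
      omega
  · have e0' : expo (σ (k, 1)) = 2 * (σ (k, 1)).1 + 1 := by omega
    have hv : expo (σ (σ.symm ((σ (k, 1)).1, 0))) = 2 * (σ (k, 1)).1 := by
      rw [Equiv.apply_symm_apply]; simp [expo]
    have := key _ _ _ hv e0'
    generalize σ.symm ((σ (k, 1)).1, 0) = x at hv this
    obtain ⟨k', e'⟩ := x
    simp only at this
    subst this
    fin_cases e'
    · have : expo (σ (k', 0)) = 2 * (σ (k', 1)).1 := hv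
      omega
    · have : expo (σ (k', 1)) = 2 * (σ (k', 1)).1 := hv
      omega

theorem bijective_fst_perm {N : ℕ} (σ : Equiv.Perm (Fin N × Fin 2))
    (h : ∀ k, (σ (k, 0)).1 = (σ (k, 1)).1) :
    Function.Bijective fun k => (σ (k, 0)).1 := by
  rw [← Finite.injective_iff_bijective]
  intro k l hkl
  have h2 : (σ (k, 0)).2 ≠ (σ (k, 1)).2 := fun h2 => by
    have := σ.injective (Prod.ext (h k) h2)
    simp at this
  have h3 : σ (l, 0) = σ (k, 0) ∨ σ (l, 0) = σ (k, 1) := by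
    have : (σ (l, 0)).2 = (σ (k, 0)).2 ∨ (σ (l, 0)).2 = (σ (k, 1)).2 := by omega
    rcases this with h4 | h4
    · exact Or.inl (Prod.ext hkl.symm h4)
    · exact Or.inr (Prod.ext (hkl.symm.trans (h k)) h4)
  rcases h3 with h3 | h3 <;> have := σ.injective h3 <;> simp_all

/-- The skew moment `∫ z ^ p (conj z) ^ q (z - conj z) w(z)` of a radial weight with moments
`m q = ∫ |z| ^ (2 q) w(z)`. -/
def skewMoment (m : ℕ → ℂ) (p q : ℕ) : ℂ :=
  (if p + 1 = q then m q else 0) - if p = q + 1 then m p else 0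

/-- The point is that `C` depends on `σ` alone and not on the moments: it is a sign when `σ`
respects the pairing and `0` otherwise. -/
theorem exists_prod_skewMoment {N : ℕ} (σ : Equiv.Perm (Fin N × Fin 2)) :
    ∃ C : ℂ, ∀ m : ℕ → ℂ,
      ∏ k, skewMoment m (expo (σ (k, 0))) (expo (σ (k, 1))) = C * ∏ j : Fin N, m (2 * j + 1) := by
  by_cases h : ∀ k, expo (σ (k, 1)) = expo (σ (k, 0)) + 1 ∨ expo (σ (k, 0)) = expo (σ (k, 1)) + 1
  · have h1 := fst_perm_eq σ h
    refine ⟨∏ k, if (σ (k, 0)).2 = 0 then 1 else -1, fun m => ?_⟩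
    rw [← (bijective_fst_perm σ h1).prod_comp (fun j => m (2 * j + 1)), ← Finset.prod_mul_distrib]
    refine Finset.prod_congr rfl fun k _ => ?_
    have e0 : expo (σ (k, 0)) = (σ (k, 0)).2 + 2 * (σ (k, 0)).1 := rfl
    have e1 : expo (σ (k, 1)) = (σ (k, 1)).2 + 2 * (σ (k, 0)).1 := by rw [h1 k]; rfl
    have b0 := (σ (k, 0)).2.2
    have b1 := (σ (k, 1)).2.2
    unfold skewMoment
    rcases h k with hk | hk
    · have : (σ (k, 0)).2 = 0 := by omega
      rw [if_pos hk.symm, if_neg (by omega), if_pos this, sub_zero, one_mul]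
      congr 1
      omega
    · have : (σ (k, 0)).2 ≠ 0 := by omega
      rw [if_neg (by omega), if_pos hk, if_neg this, zero_sub, neg_one_mul]
      congr 2
      omega
  · push Not at h
    obtain ⟨k, h1, h2⟩ := h
    refine ⟨0, fun m => ?_⟩
    rw [zero_mul]
    refine Finset.prod_eq_zero (Finset.mem_univ k) ?_
    unfold skewMoment
    rw [if_neg (Ne.symm h1), if_neg h2, sub_zero]

/-! ### Factorization of radial product integrals. -/

/-- The moment `∫ |z| ^ (2 q) h(|z|) exp (- c |z|²)`. -/
noncomputable def radialMoment (c : ℝ) (h : ℝ → ℂ) (q : ℕ) : ℂ :=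
  ∫ z : ℂ, ((‖z‖ ^ (2 * q) : ℝ) : ℂ) * (h ‖z‖ * (Real.exp (-c * ‖z‖ ^ 2) : ℂ))

section RadialIntegral

variable {c : ℝ} {h : ℝ → ℂ} {K : ℝ}

theorem integrable_monomial (hc : 0 < c) (hm : Measurable h) (hK : ∀ x, ‖h x‖ ≤ K) (p q : ℕ) :
    Integrable fun z : ℂ =>
      z ^ p * (starRingEnd ℂ) z ^ q * (h ‖z‖ * (Real.exp (-c * ‖z‖ ^ 2) : ℂ)) := by
  refine ((integrable_factor (p + q) hc).const_mul K).mono' (by fun_prop)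
    (Eventually.of_forall fun z => ?_)
  have h0 : 0 ≤ K := (norm_nonneg _).trans (hK 0)
  rw [norm_mul, norm_mul, norm_mul, norm_pow, norm_pow, RCLike.norm_conj, Complex.norm_real,
    Real.norm_of_nonneg (Real.exp_pos _).le, ← pow_add]
  calc ‖z‖ ^ (p + q) * (‖h ‖z‖‖ * Real.exp (-c * ‖z‖ ^ 2))
      ≤ (1 + ‖z‖) ^ (p + q) * (K * Real.exp (-c * ‖z‖ ^ 2)) := by
        gcongr
        · linarith
        · exact hK _
    _ = _ := by ring

theorem integral_monomial (p q : ℕ) :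
    ∫ z : ℂ, z ^ p * (starRingEnd ℂ) z ^ q * (h ‖z‖ * (Real.exp (-c * ‖z‖ ^ 2) : ℂ)) =
      if p = q then radialMoment c h q else 0 := by
  split_ifs with hpq
  · subst hpq
    unfold radialMoment
    congr 1 with z
    rw [← mul_pow, Complex.mul_conj', pow_mul]
    push_cast
    rfl
  · -- rotating by an angle `θ` with `θ (p - q) = π` changes the sign
    have hpq' : (p : ℝ) - q ≠ 0 := sub_ne_zero.2 (by exact_mod_cast hpq)
    set θ : ℝ := Real.pi / (p - q) with hθ
    set I := ∫ z : ℂ, z ^ p * (starRingEnd ℂ) z ^ q *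
      (h ‖z‖ * (Real.exp (-c * ‖z‖ ^ 2) : ℂ)) with hI
    have h1 := (rotation (Circle.exp θ)).measurePreserving.integral_comp
      (rotation (Circle.exp θ)).toHomeomorph.measurableEmbedding
      (fun z : ℂ => z ^ p * (starRingEnd ℂ) z ^ q * (h ‖z‖ * (Real.exp (-c * ‖z‖ ^ 2) : ℂ)))
    have h2 : ((Circle.exp θ : Circle) : ℂ) ^ p * (starRingEnd ℂ) (Circle.exp θ : ℂ) ^ q = -1 := by
      rw [Circle.coe_exp, ← Complex.exp_conj, ← Complex.exp_nat_mul, ← Complex.exp_nat_mul,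
        ← Complex.exp_add, ← Complex.exp_pi_mul_I]
      congr 1
      rw [map_mul, Complex.conj_ofReal, Complex.conj_I, hθ]
      have : (p : ℂ) - q ≠ 0 := by exact_mod_cast hpq'
      push_cast
      field_simp
      ring
    have h3 : ∀ z : ℂ, (rotation (Circle.exp θ) z) ^ p *
        (starRingEnd ℂ) (rotation (Circle.exp θ) z) ^ q *
        (h ‖rotation (Circle.exp θ) z‖ * (Real.exp (-c * ‖rotation (Circle.exp θ) z‖ ^ 2) : ℂ)) =
        -1 * (z ^ p * (starRingEnd ℂ) z ^ q * (h ‖z‖ * (Real.exp (-c * ‖z‖ ^ 2) : ℂ))) := by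
      intro z
      rw [LinearIsometryEquiv.norm_map, rotation_apply, map_mul, mul_pow, mul_pow, ← h2]
      ring
    simp_rw [h3] at h1
    rw [integral_const_mul, ← hI] at h1
    have h4 : (2 : ℂ) * I = 0 := by linear_combination -h1
    simpa using h4

theorem integral_skew (hc : 0 < c) (hm : Measurable h) (hK : ∀ x, ‖h x‖ ≤ K) (p q : ℕ) :
    ∫ z : ℂ, z ^ p * (starRingEnd ℂ) z ^ q *
      ((z - (starRingEnd ℂ) z) * (h ‖z‖ * (Real.exp (-c * ‖z‖ ^ 2) : ℂ))) =
      skewMoment (radialMoment c h) p q := by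
  have e : ∀ z : ℂ, z ^ p * (starRingEnd ℂ) z ^ q *
      ((z - (starRingEnd ℂ) z) * (h ‖z‖ * (Real.exp (-c * ‖z‖ ^ 2) : ℂ))) =
      z ^ (p + 1) * (starRingEnd ℂ) z ^ q * (h ‖z‖ * (Real.exp (-c * ‖z‖ ^ 2) : ℂ)) -
      z ^ p * (starRingEnd ℂ) z ^ (q + 1) * (h ‖z‖ * (Real.exp (-c * ‖z‖ ^ 2) : ℂ)) :=
    fun z => by ring
  simp_rw [e]
  rw [integral_sub (integrable_monomial hc hm hK _ _) (integrable_monomial hc hm hK _ _),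
    integral_monomial, integral_monomial, skewMoment]
  congr 1
  split_ifs with hpq
  · rw [hpq]
  · rfl

theorem integrable_skew (hc : 0 < c) (hm : Measurable h) (hK : ∀ x, ‖h x‖ ≤ K) (p q : ℕ) :
    Integrable fun z : ℂ => z ^ p * (starRingEnd ℂ) z ^ q *
      ((z - (starRingEnd ℂ) z) * (h ‖z‖ * (Real.exp (-c * ‖z‖ ^ 2) : ℂ))) := by
  refine ((integrable_monomial hc hm hK (p + 1) q).sub
    (integrable_monomial hc hm hK p (q + 1))).congr (Eventually.of_forall fun z => ?_)
  simp only [Pi.sub_apply]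
  ring

/-- Integrals of radial product functions against the eigenvalue density factorize. -/
theorem exists_integral_weight_mul_prod {N : ℕ} (hN : 0 < N) :
    ∃ C : ℂ, ∀ (h : ℝ → ℂ) (K : ℝ), Measurable h → (∀ x, ‖h x‖ ≤ K) →
      ∫ z : Fin N → ℂ, (weight N z : ℂ) * ∏ k, h ‖z k‖ =
        C * ∏ j : Fin N, radialMoment (2 * N) h (2 * j + 1) := by
  choose C hC using exists_prod_skewMoment (N := N)
  refine ⟨∑ σ, ((Equiv.Perm.sign σ : ℤ) : ℂ) * C σ, fun h K hm hK => ?_⟩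
  have hc : (0 : ℝ) < 2 * N := by positivity
  have e : ∀ z : Fin N → ℂ, (weight N z : ℂ) * ∏ k, h ‖z k‖ =
      ∑ σ : Equiv.Perm (Fin N × Fin 2), ((Equiv.Perm.sign σ : ℤ) : ℂ) *
        ∏ k, (z k ^ expo (σ (k, 0)) * (starRingEnd ℂ) (z k) ^ expo (σ (k, 1)) *
          ((z k - (starRingEnd ℂ) (z k)) *
            (h ‖z k‖ * (Real.exp (-(2 * N) * ‖z k‖ ^ 2) : ℂ)))) := by
    intro z
    -- After transposing, `σ` acts on the exponents, so each term is a product over `k` of functions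
    -- of `z k` alone.
    rw [weight_eq_det, ← Matrix.det_transpose, Matrix.det_apply', Finset.sum_mul,
      Finset.sum_mul]
    refine Finset.sum_congr rfl fun σ _ => ?_
    simp only [Matrix.transpose_apply, Matrix.of_apply, Fintype.prod_prod_type, Fin.prod_univ_two,
      conjPair, if_true, one_ne_zero, if_false]
    rw [mul_assoc, mul_assoc, ← Finset.prod_mul_distrib, ← Finset.prod_mul_distrib]
    congr 1
    refine Finset.prod_congr rfl fun k _ => ?_
    ring
  simp_rw [e]
  rw [integral_finsetSum, Finset.sum_mul]
  · refine Finset.sum_congr rfl fun σ _ => ?_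
    rw [integral_const_mul, volume_pi, integral_fintype_prod_eq_prod (𝕜 := ℂ) (f := fun k (z : ℂ) =>
      z ^ expo (σ (k, 0)) * (starRingEnd ℂ) z ^ expo (σ (k, 1)) *
          ((z - (starRingEnd ℂ) z) * (h ‖z‖ * (Real.exp (-(2 * N) * ‖z‖ ^ 2) : ℂ))))]
    simp_rw [integral_skew hc hm hK]
    rw [hC, mul_assoc]
  · intro σ _
    exact (Integrable.fintype_prod (𝕜 := ℂ) (μ := fun _ => volume)
      fun k : Fin N => integrable_skew hc hm hK (expo (σ (k, 0))) (expo (σ (k, 1)))).const_mul _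

theorem integral_law (N : ℕ) (f : (Fin N → ℂ) → ℂ) :
    ∫ z, f z ∂(law N) =
      ((partitionFunction N)⁻¹).toReal * ∫ z : Fin N → ℂ, (weight N z : ℂ) * f z := by
  rw [law, integral_smul_measure, integral_withDensity_eq_integral_toReal_smul
    (by have := continuous_weight N; fun_prop)
    (Eventually.of_forall fun _ => ENNReal.ofReal_lt_top)]
  simp only [ENNReal.toReal_ofReal (weight_nonneg N _), Complex.real_smul]

/-- Under the eigenvalue law the moduli behave, for symmetric product functions, like independent
variables. -/
theorem integral_prod_law {N : ℕ} (hN : 0 < N) (hm : Measurable h) (hK : ∀ x, ‖h x‖ ≤ K) :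
    ∫ z, ∏ k, h ‖z k‖ ∂(law N) = ∏ j : Fin N,
      (radialMoment (2 * N) h (2 * j + 1) / radialMoment (2 * N) (fun _ => 1) (2 * j + 1)) := by
  obtain ⟨C, hC⟩ := exists_integral_weight_mul_prod hN
  -- Total mass one determines `C` and also shows that the denominators do not vanish.
  have h1 : (1 : ℂ) = ∫ z, ∏ k : Fin N, (fun _ => 1 : ℝ → ℂ) ‖z k‖ ∂(law N) := by simp
  rw [integral_law, hC _ 1 measurable_const (by simp)] at h1
  rw [integral_law, hC _ K hm hK, Finset.prod_div_distrib, eq_div_iff]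
  · linear_combination
      (-∏ j : Fin N, radialMoment (2 * N) h (2 * j + 1)) * h1
  · intro h0
    simp [h0] at h1

end RadialIntegral

/-! ### Radial moments and Gamma probabilities. -/

/-- The density of the Gamma distribution of shape `n + 1` and rate `1`. -/
noncomputable def gammaDensity (n : ℕ) (t : ℝ) : ℝ := t ^ n * Real.exp (-t) / n.factorial

/-- The mass of `[A, B]` under the Gamma distribution of shape `n + 1`, for `0 ≤ A`. -/
noncomputable def gammaProb (n : ℕ) (A B : ℝ) : ℝ := ∫ t in Set.Icc A B, gammaDensity n t

theorem continuous_gammaDensity (n : ℕ) : Continuous (gammaDensity n) := by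
  unfold gammaDensity
  fun_prop

theorem gammaDensity_nonneg (n : ℕ) {t : ℝ} (ht : 0 ≤ t) : 0 ≤ gammaDensity n t := by
  unfold gammaDensity
  positivity

theorem integrableOn_gammaDensity (n : ℕ) : IntegrableOn (gammaDensity n) (Set.Ioi 0) := by
  have h := (Real.GammaIntegral_convergent (s := n + 1) (by positivity)).div_const
    (n.factorial : ℝ)
  refine h.congr (Eventually.of_forall fun t => ?_)
  simp [gammaDensity, mul_comm]

theorem integral_gammaDensity (n : ℕ) : ∫ t in Set.Ioi 0, gammaDensity n t = 1 := by
  have h := Real.Gamma_eq_integral (s := n + 1) (by positivity)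
  rw [Real.Gamma_nat_eq_factorial] at h
  unfold gammaDensity
  rw [integral_div, div_eq_one_iff_eq (by positivity), h]
  simp [mul_comm]

theorem gammaProb_nonneg (n : ℕ) {A B : ℝ} (hA : 0 ≤ A) : 0 ≤ gammaProb n A B :=
  setIntegral_nonneg measurableSet_Icc fun _ ht => gammaDensity_nonneg n (hA.trans ht.1)

theorem gammaProb_eq (n : ℕ) {A B : ℝ} (hA : 0 ≤ A) :
    gammaProb n A B = ∫ t in Set.Ioi 0, (Set.Icc A B).indicator (gammaDensity n) t := by
  rw [gammaProb, ← integral_Ici_eq_integral_Ioi, setIntegral_indicator measurableSet_Icc,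
    
    Set.inter_eq_right.2 (Set.Icc_subset_Ici_self.trans (Set.Ici_subset_Ici.2 hA))]

theorem gammaProb_le_one (n : ℕ) {A B : ℝ} (hA : 0 ≤ A) : gammaProb n A B ≤ 1 := by
  rw [gammaProb_eq n hA, ← integral_gammaDensity n]
  refine setIntegral_mono_on ((integrableOn_gammaDensity n).indicator measurableSet_Icc)
    (integrableOn_gammaDensity n) measurableSet_Ioi fun t ht => ?_
  exact Set.indicator_le_self' (fun _ _ => gammaDensity_nonneg n (le_of_lt ht)) t

/-- Polar coordinates followed by the substitution `t = c r²`. The prefactor does not depend on `g`,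
so it cancels in ratios. -/
theorem radialMoment_eq {c : ℝ} (hc : 0 < c) (g : ℝ → ℂ) (n : ℕ) :
    radialMoment c (fun r => g (c * r ^ 2)) n =
      ((Real.pi * n.factorial / c ^ (n + 1) : ℝ) : ℂ) *
        ∫ t in Set.Ioi (0 : ℝ), (gammaDensity n t : ℂ) * g t := by
  set H : ℝ → ℂ := fun t => (gammaDensity n t : ℂ) * g t with hH
  have h1 := integral_fun_norm_addHaar (volume : Measure ℂ) fun r : ℝ =>
    ((r ^ (2 * n) : ℝ) : ℂ) * (g (c * r ^ 2) * (Real.exp (-c * r ^ 2) : ℂ))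
  have h2 : ∫ y in Set.Ioi (0 : ℝ), y ^ (Module.finrank ℝ ℂ - 1) •
      (((y ^ (2 * n) : ℝ) : ℂ) * (g (c * y ^ 2) * (Real.exp (-c * y ^ 2) : ℂ))) =
      ((n.factorial / (2 * c ^ n) : ℝ) : ℂ) *
        ∫ y in Set.Ioi (0 : ℝ), (2 * y ^ ((2 : ℝ) - 1)) • H (c * y ^ (2 : ℝ)) := by
    rw [← integral_const_mul]
    refine setIntegral_congr_fun measurableSet_Ioi fun y _ => ?_
    have e1 : y ^ ((2 : ℝ) - 1) = y := by norm_num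
    have e2 : y ^ (2 : ℝ) = y ^ 2 := by norm_num
    have hn : (n.factorial : ℂ) ≠ 0 := by exact_mod_cast n.factorial_ne_zero
    have hc' : (c : ℂ) ≠ 0 := by exact_mod_cast hc.ne'
    simp only [Complex.finrank_real_complex, e1, e2, hH, gammaDensity, Complex.real_smul,
      Nat.add_one_sub_one, pow_one, neg_mul]
    push_cast
    rw [mul_pow, ← pow_mul]
    field_simp
  unfold radialMoment
  rw [h1, h2, integral_comp_rpow_Ioi_of_pos (g := fun u => H (c * u)) two_pos,
    integral_comp_mul_left_Ioi H 0 hc, mul_zero, Complex.finrank_real_complex, Measure.real,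
    Complex.volume_ball]
  simp only [Complex.real_smul, nsmul_eq_mul]
  have hc' : (c : ℂ) ≠ 0 := by exact_mod_cast hc.ne'
  simp
  field_simp
  ring

theorem radialMoment_ratio {c : ℝ} (hc : 0 < c) {a b : ℝ} (ha : 0 ≤ a) (hb : 0 ≤ b) (s : ℂ)
    (n : ℕ) :
    radialMoment c (fun r => 1 + s * (Set.Icc a b).indicator 1 r) n /
      radialMoment c (fun _ => 1) n = 1 + s * gammaProb n (c * a ^ 2) (c * b ^ 2) := by
  set A := c * a ^ 2
  set B := c * b ^ 2
  have hA : 0 ≤ A := by positivity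
  have e : radialMoment c (fun r => 1 + s * (Set.Icc a b).indicator 1 r) n =
      radialMoment c (fun r => (fun t => 1 + s * (Set.Icc A B).indicator 1 t) (c * r ^ 2)) n := by
    unfold radialMoment
    congr 1 with z
    have : (‖z‖ ∈ Set.Icc a b) ↔ c * ‖z‖ ^ 2 ∈ Set.Icc A B := by
      simp only [Set.mem_Icc, A, B]
      rw [mul_le_mul_iff_right₀ hc, mul_le_mul_iff_right₀ hc,
        pow_le_pow_iff_left₀ ha (norm_nonneg z) two_ne_zero,
        pow_le_pow_iff_left₀ (norm_nonneg z) hb two_ne_zero]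
    simp only [Set.indicator_apply, this, Pi.one_apply]
  have i1 : ∫ t in Set.Ioi (0 : ℝ), (gammaDensity n t : ℂ) * (1 : ℂ) = 1 := by
    simp only [mul_one]
    rw [integral_complex_ofReal, integral_gammaDensity, Complex.ofReal_one]
  have hint : IntegrableOn (fun t => (gammaDensity n t : ℂ)) (Set.Ioi 0) :=
    (integrableOn_gammaDensity n).ofReal
  have hint' : IntegrableOn (fun t => (((Set.Icc A B).indicator (gammaDensity n) t : ℝ) : ℂ))
      (Set.Ioi 0) :=
    ((integrableOn_gammaDensity n).indicator measurableSet_Icc).ofReal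
  have i2 : ∫ t in Set.Ioi (0 : ℝ), (gammaDensity n t : ℂ) *
      (1 + s * (Set.Icc A B).indicator 1 t) = 1 + s * gammaProb n A B := by
    have : ∀ t : ℝ, (gammaDensity n t : ℂ) * (1 + s * (Set.Icc A B).indicator 1 t) =
        (gammaDensity n t : ℂ) + s * ((Set.Icc A B).indicator (gammaDensity n) t : ℝ) := by
      intro t
      by_cases ht : t ∈ Set.Icc A B
      · simp only [Set.indicator_of_mem ht, Pi.one_apply]; ring
      · simp only [Set.indicator_of_notMem ht]; simp
    simp_rw [this]
    rw [integral_add hint (hint'.const_mul s), integral_const_mul, integral_complex_ofReal,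
      integral_complex_ofReal, integral_gammaDensity, ← gammaProb_eq n hA, Complex.ofReal_one]
  have hne : ((Real.pi * n.factorial / c ^ (n + 1) : ℝ) : ℂ) ≠ 0 := by
    exact_mod_cast (by positivity : Real.pi * n.factorial / c ^ (n + 1) ≠ 0)
  rw [e.trans (radialMoment_eq hc (fun t => 1 + s * (Set.Icc A B).indicator 1 t) n),
    radialMoment_eq hc (fun _ => 1), i1, i2, mul_one,
    mul_div_cancel_left₀ _ hne]

/-! ### Characteristic function of the count. -/

/-- The parameter of the `j`-th Bernoulli variable in the decomposition of the radial count. -/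
noncomputable def bernoulliParam (N : ℕ) (a b : ℝ) (j : ℕ) : ℝ :=
  gammaProb (2 * j + 1) (2 * N * a ^ 2) (2 * N * b ^ 2)

theorem bernoulliParam_nonneg (N : ℕ) (a b : ℝ) (j : ℕ) : 0 ≤ bernoulliParam N a b j :=
  gammaProb_nonneg _ (by positivity)

theorem bernoulliParam_le_one (N : ℕ) (a b : ℝ) (j : ℕ) : bernoulliParam N a b j ≤ 1 :=
  gammaProb_le_one _ (by positivity)

theorem measurable_radialCount (N : ℕ) (a b : ℝ) :
    Measurable (radialCount a b : (Fin N → ℂ) → ℝ) := by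
  have hs : MeasurableSet {w : ℂ | ‖w‖ ∈ Set.Icc a b} := measurable_norm measurableSet_Icc
  have : Measurable (Set.indicator {w : ℂ | ‖w‖ ∈ Set.Icc a b} (1 : ℂ → ℝ)) :=
    measurable_one.indicator hs
  unfold radialCount linearStatistic
  fun_prop

/-- Since `exp (i t 1_S) = 1 + (exp (i t) - 1) 1_S`, the exponential of the count is a radial
product, to which `integral_prod_law` applies. -/
theorem charFun_radialCount {N : ℕ} (hN : 0 < N) {a b : ℝ} (ha : 0 ≤ a) (hb : 0 ≤ b) (t : ℝ) :
    charFun ((law N).map (radialCount a b)) t =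
      ∏ j : Fin N, (1 + (Complex.exp (t * Complex.I) - 1) * bernoulliParam N a b j) := by
  set s : ℂ := Complex.exp (t * Complex.I) - 1 with hs
  have hc : (0 : ℝ) < 2 * N := by positivity
  rw [charFun_apply_real, integral_map (measurable_radialCount N a b).aemeasurable
    (by fun_prop)]
  have hm : Measurable fun r : ℝ => 1 + s * (Set.Icc a b).indicator 1 r :=
    ((measurable_one.indicator measurableSet_Icc).const_mul s).const_add 1
  have hK : ∀ r : ℝ, ‖1 + s * (Set.Icc a b).indicator 1 r‖ ≤ 1 + ‖s‖ := by
    intro r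
    refine (norm_add_le _ _).trans ?_
    rw [norm_one, norm_mul]
    gcongr
    refine mul_le_of_le_one_right (norm_nonneg s) ?_
    by_cases hr : r ∈ Set.Icc a b
    · simp only [Set.indicator_of_mem hr]; simp
    · simp only [Set.indicator_of_notMem hr]; simp
  have key := integral_prod_law hN hm hK
  simp_rw [radialMoment_ratio hc ha hb s] at key
  unfold bernoulliParam
  rw [← key]
  congr 1 with z
  unfold radialCount linearStatistic
  push_cast
  rw [Finset.mul_sum, Finset.sum_mul, Complex.exp_sum]
  refine Finset.prod_congr rfl fun k _ => ?_
  by_cases hk : ‖z k‖ ∈ Set.Icc a b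
  · have hk' : z k ∈ {w : ℂ | ‖w‖ ∈ Set.Icc a b} := hk
    rw [Set.indicator_of_mem hk, Set.indicator_of_mem hk', hs]
    simp
  · have hk' : z k ∉ {w : ℂ | ‖w‖ ∈ Set.Icc a b} := hk
    rw [Set.indicator_of_notMem hk, Set.indicator_of_notMem hk']
    simp

/-! ### Divergence of the variance. -/

theorem factorial_le_stirling {n : ℕ} (hn : 1 ≤ n) :
    (n.factorial : ℝ) ≤ Real.exp 1 * √n * (n / Real.exp 1) ^ n := by
  obtain ⟨m, rfl⟩ : ∃ m, n = m + 1 := ⟨n - 1, by omega⟩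
  -- The ratios `n! / (√(2 n) (n / e) ^ n)` decrease from their value `e / √2` at `n = 1`.
  have h := Stirling.stirlingSeq'_antitone (Nat.zero_le m)
  simp only [Function.comp_apply, Nat.succ_eq_add_one, zero_add, Stirling.stirlingSeq_one] at h
  rw [Stirling.stirlingSeq, div_le_iff₀ (by positivity)] at h
  refine h.trans_eq ?_
  rw [Real.sqrt_mul zero_le_two]
  field_simp

/-- Stirling's bound handles the factorial, and `log x ≥ 1 - 1 / x` at `x = t / n` gives the
Gaussian-type exponent. -/
theorem le_gammaDensity {n : ℕ} (hn : 1 ≤ n) {t : ℝ} (ht : 0 < t) :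
    Real.exp (-1 - (t - n) ^ 2 / t) / √n ≤ gammaDensity n t := by
  have hn' : (0 : ℝ) < n := by exact_mod_cast hn
  have hlog : -((t - n) ^ 2 / t) ≤ n * Real.log (t / n) + n - t := by
    have h1 := Real.one_sub_inv_le_log_of_pos (div_pos ht hn')
    have h2 := mul_le_mul_of_nonneg_left h1 hn'.le
    have h3 : n * (1 - (t / n)⁻¹) + n - t = -((t - n) ^ 2 / t) := by
      field_simp
      ring
    linarith
  have hpow : t ^ n = Real.exp (n * Real.log (t / n)) * n ^ n := by
    rw [Real.exp_nat_mul, Real.exp_log (div_pos ht hn'), ← mul_pow, div_mul_cancel₀ _ hn'.ne']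
  have hs : 0 < √(n : ℝ) := Real.sqrt_pos.2 hn'
  unfold gammaDensity
  rw [div_le_div_iff₀ hs (by positivity), hpow]
  have hexp : Real.exp (n : ℝ) = Real.exp 1 ^ n := by rw [← Real.exp_nat_mul, mul_one]
  calc Real.exp (-1 - (t - n) ^ 2 / t) * n.factorial
      ≤ Real.exp (-1 - (t - n) ^ 2 / t) * (Real.exp 1 * √n * (n / Real.exp 1) ^ n) := by
        gcongr
        exact factorial_le_stirling hn
    _ = Real.exp (-((t - n) ^ 2 / t)) * (√n * (n ^ n / Real.exp n)) := by
        rw [sub_eq_add_neg, Real.exp_add, Real.exp_neg 1, div_pow, hexp]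
        field_simp
    _ ≤ Real.exp (n * Real.log (t / n) + n - t) * (√n * (n ^ n / Real.exp n)) := by gcongr
    _ = Real.exp (n * Real.log (t / n)) * n ^ n * Real.exp (-t) * √n := by
        rw [sub_eq_add_neg, Real.exp_add, Real.exp_add]
        field_simp

theorem le_gammaDensity_of_near {B t : ℝ} (hB : 16 ≤ B) {n : ℕ} (hn : B - √B ≤ n) (hn' : n ≤ B)
    (ht : B - √B ≤ t) (ht' : t ≤ B + √B) : Real.exp (-9) / √B ≤ gammaDensity n t := by
  have hB0 : 0 ≤ B := by linarith
  have hs : 4 ≤ √B := Real.le_sqrt_of_sq_le (by linarith)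
  have hsq : √B * √B = B := Real.mul_self_sqrt hB0
  have h1 : B / 2 ≤ B - √B := by nlinarith
  have hn1 : 1 ≤ n := by
    have : (1 : ℝ) ≤ n := by linarith
    exact_mod_cast this
  have hn0 : (0 : ℝ) < n := by exact_mod_cast hn1
  have ht0 : 0 < t := by linarith
  -- Here `|t - n| ≤ 2 √B` and `t ≥ B / 2`; adding the `1` from Stirling's bound gives the exponent
  -- `-9`.
  have hd : (t - n) ^ 2 / t ≤ 8 := by
    rw [div_le_iff₀ ht0]
    have : (t - n) ^ 2 ≤ (2 * √B) ^ 2 := sq_le_sq' (by linarith) (by linarith)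
    nlinarith
  refine le_trans ?_ (le_gammaDensity hn1 ht0)
  have hsn : 0 < √(n : ℝ) := Real.sqrt_pos.2 hn0
  gcongr
  linarith

theorem gammaProb_mono (n : ℕ) {A A' B : ℝ} (hA : 0 ≤ A) (h : A ≤ A') :
    gammaProb n A' B ≤ gammaProb n A B := by
  refine setIntegral_mono_set (continuous_gammaDensity n).integrableOn_Icc ?_
    (Set.Icc_subset_Icc_left h).eventuallyLE
  filter_upwards [ae_restrict_mem measurableSet_Icc] with t ht
  exact gammaDensity_nonneg n (hA.trans ht.1)

theorem mul_le_gammaProb (n : ℕ) {A B d : ℝ} (hAB : A ≤ B)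
    (h : ∀ t ∈ Set.Icc A B, d ≤ gammaDensity n t) : (B - A) * d ≤ gammaProb n A B := by
  have h1 := setIntegral_mono_on (μ := volume) (s := Set.Icc A B) (f := fun _ => d)
    (continuous_const.integrableOn_Icc) (continuous_gammaDensity n).integrableOn_Icc
    measurableSet_Icc h
  rw [setIntegral_const, Real.volume_real_Icc_of_le hAB, smul_eq_mul] at h1
  exact h1

theorem gammaProb_add_le_one (n : ℕ) {A B C : ℝ} (hA : 0 ≤ A) (hAB : A ≤ B) (hBC : B ≤ C) :
    gammaProb n A B + gammaProb n B C ≤ 1 := by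
  refine le_trans (le_of_eq ?_) (gammaProb_le_one n (B := C) hA)
  unfold gammaProb
  simp_rw [integral_Icc_eq_integral_Ioc]
  rw [← setIntegral_union (Set.Ioc_disjoint_Ioc_of_le le_rfl) measurableSet_Ioc
    ((continuous_gammaDensity n).integrableOn_Ioc)
    ((continuous_gammaDensity n).integrableOn_Ioc), Set.Ioc_union_Ioc_eq_Ioc hAB hBC]

/-- The Bernoulli variances are bounded below when the mean of the Gamma variable lies in a window
of width `√B` to the left of `B`. -/
theorem le_gammaProb_mul_one_sub {A B : ℝ} (hA : 0 ≤ A) (hAB : A ≤ B) (hB : 16 ≤ B) {n : ℕ}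
    (hn : B - √B ≤ n) (hn' : n ≤ B) :
    Real.exp (-9) ^ 2 * (min (B - A) √B / √B) ≤ gammaProb n A B * (1 - gammaProb n A B) := by
  have hs : 4 ≤ √B := Real.le_sqrt_of_sq_le (by linarith)
  have hs0 : 0 < √B := by linarith
  have hsq : √B * √B = B := Real.mul_self_sqrt (by linarith)
  -- The part of `[A, B]` within `√B` of `B` bounds the success probability below; the disjoint
  -- interval `[B, B + √B]` does the same for the failure probability in `h2`.
  have h1 : Real.exp (-9) * (min (B - A) √B / √B) ≤ gammaProb n A B := by
    refine le_trans ?_ (gammaProb_mono n hA (le_max_left A (B - √B)))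
    have := mul_le_gammaProb n (d := Real.exp (-9) / √B) (max_le hAB (by linarith : B - √B ≤ B))
      fun t ht => le_gammaDensity_of_near hB hn hn' ((le_max_right _ _).trans ht.1)
        (by linarith [ht.2])
    rw [← min_sub_sub_left, sub_sub_cancel] at this
    refine le_trans (le_of_eq ?_) this
    ring
  have h2 : Real.exp (-9) ≤ 1 - gammaProb n A B := by
    have h3 := mul_le_gammaProb n (d := Real.exp (-9) / √B) (by linarith : B ≤ B + √B)
      fun t ht => le_gammaDensity_of_near hB hn hn' (by linarith [ht.1]) ht.2
    rw [add_sub_cancel_left, mul_div_cancel₀ _ hs0.ne'] at h3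
    have := gammaProb_add_le_one n hA hAB (by linarith : B ≤ B + √B)
    linarith
  have hm : 0 ≤ min (B - A) √B / √B := div_nonneg (le_min (by linarith) hs0.le) hs0.le
  calc Real.exp (-9) ^ 2 * (min (B - A) √B / √B)
      = (Real.exp (-9) * (min (B - A) √B / √B)) * Real.exp (-9) := by ring
    _ ≤ _ := mul_le_mul h1 h2 (Real.exp_pos _).le (gammaProb_nonneg n hA)

theorem le_sum_gammaProb {A B : ℝ} (hA : 0 ≤ A) (hAB : A ≤ B) (hB : 16 ≤ B) {N : ℕ}
    (hBN : B ≤ 2 * N) :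
    Real.exp (-9) ^ 2 / 4 * min (B - A) √B ≤
      ∑ j : Fin N, gammaProb (2 * j + 1) A B * (1 - gammaProb (2 * j + 1) A B) := by
  have hs : 4 ≤ √B := Real.le_sqrt_of_sq_le (by linarith)
  have hs0 : 0 < √B := by linarith
  have hsq : √B * √B = B := Real.mul_self_sqrt (by linarith)
  set x : ℝ := (B - √B - 1) / 2 with hx
  set y : ℝ := (B - 1) / 2 with hy
  have hx0 : 0 ≤ x := by rw [hx]; nlinarith
  have hy0 : 0 ≤ y := by rw [hy]; linarith
  have hm : 0 ≤ min (B - A) √B := le_min (by linarith) hs0.le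
  have hsub : Finset.Icc ⌈x⌉₊ ⌊y⌋₊ ⊆ Finset.range N := by
    intro j hj
    have h1 := (Nat.le_floor_iff hy0).1 (Finset.mem_Icc.1 hj).2
    have h2 : (j : ℝ) < N := by linarith
    exact Finset.mem_range.2 (by exact_mod_cast h2)
  -- These `j` are those with `2 j + 1 ∈ [B - √B, B]`. There are at least `y - x - 1 = √B / 2 - 1`
  -- of them, which is enough because `√B ≥ 4`.
  have hcard : √B / 4 ≤ (Finset.Icc ⌈x⌉₊ ⌊y⌋₊).card := by
    have h1 : ((⌊y⌋₊ + 1 : ℕ) : ℝ) ≤ ((⌊y⌋₊ + 1 - ⌈x⌉₊ : ℕ) : ℝ) + (⌈x⌉₊ : ℕ) := by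
      exact_mod_cast le_tsub_add
    have h2 := Nat.lt_floor_add_one y
    have h3 := Nat.ceil_lt_add_one hx0
    rw [Nat.card_Icc]
    push_cast at h1
    linarith
  rw [Fin.sum_univ_eq_sum_range fun j => gammaProb (2 * j + 1) A B *
    (1 - gammaProb (2 * j + 1) A B)]
  calc Real.exp (-9) ^ 2 / 4 * min (B - A) √B
      = √B / 4 * (Real.exp (-9) ^ 2 * (min (B - A) √B / √B)) := by field_simp
    _ ≤ (Finset.Icc ⌈x⌉₊ ⌊y⌋₊).card * (Real.exp (-9) ^ 2 * (min (B - A) √B / √B)) := by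
        gcongr
    _ = ∑ j ∈ Finset.Icc ⌈x⌉₊ ⌊y⌋₊, Real.exp (-9) ^ 2 * (min (B - A) √B / √B) := by
        rw [Finset.sum_const, nsmul_eq_mul]
    _ ≤ ∑ j ∈ Finset.Icc ⌈x⌉₊ ⌊y⌋₊, gammaProb (2 * j + 1) A B *
          (1 - gammaProb (2 * j + 1) A B) := by
        refine Finset.sum_le_sum fun j hj => ?_
        have h1 := (Nat.le_floor_iff hy0).1 (Finset.mem_Icc.1 hj).2
        have h2 := Nat.ceil_le.1 (Finset.mem_Icc.1 hj).1
        refine le_gammaProb_mul_one_sub hA hAB hB ?_ ?_ <;> push_cast <;> linarith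
    _ ≤ _ := Finset.sum_le_sum_of_subset_of_nonneg hsub fun j _ _ =>
        mul_nonneg (gammaProb_nonneg _ hA) (sub_nonneg.2 (gammaProb_le_one _ hA))

/-- The sum of the variances of the Bernoulli variables diverges. -/
theorem tendsto_sum_bernoulliParam (a b : ℕ → ℝ) (ε : ℝ) (hε : 0 < ε)
    (ha : ∀ᶠ N in atTop, 0 ≤ a N) (hbε : ∀ᶠ N in atTop, ε ≤ b N)
    (hb : ∀ᶠ N in atTop, b N ≤ 1)
    (hab : Tendsto (fun N : ℕ => (N : ℝ) * (b N - a N)) atTop atTop) :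
    Tendsto (fun N : ℕ => ∑ j : Fin N, bernoulliParam N (a N) (b N) j *
      (1 - bernoulliParam N (a N) (b N) j)) atTop atTop := by
  have hN : Tendsto (fun N : ℕ => 2 * ε ^ 2 * (N : ℝ)) atTop atTop :=
    tendsto_natCast_atTop_atTop.const_mul_atTop (by positivity)
  have hlow : Tendsto (fun N : ℕ => Real.exp (-9) ^ 2 / 4 *
      min (2 * ε * (N * (b N - a N))) √(2 * ε ^ 2 * (N : ℝ))) atTop atTop := by
    refine Tendsto.const_mul_atTop (by positivity) ?_
    exact tendsto_inf_atTop _ (hab.const_mul_atTop (by positivity))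
      (Real.tendsto_sqrt_atTop.comp hN)
  refine tendsto_atTop_mono' _ ?_ hlow
  filter_upwards [ha, hbε, hb, hab.eventually_ge_atTop 0, hN.eventually_ge_atTop 16,
    eventually_gt_atTop 0] with N h1 h2 h3 h4 h5 h6
  have hN0 : (0 : ℝ) < N := by exact_mod_cast h6
  have hab' : a N ≤ b N := by
    have := nonneg_of_mul_nonneg_right h4 hN0
    linarith
  have hBlow : 2 * ε ^ 2 * N ≤ 2 * N * b N ^ 2 := by
    have : ε ^ 2 ≤ b N ^ 2 := by gcongr
    nlinarith
  -- Factor `b² - a² = (b - a) (b + a)` and use `b + a ≥ ε`; this is where `b` must stay away from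
  -- `0`.
  have hdiff : 2 * ε * (N * (b N - a N)) ≤ 2 * N * b N ^ 2 - 2 * N * a N ^ 2 := by
    have : 0 ≤ N * (b N - a N) * (b N + a N - ε) := mul_nonneg h4 (by linarith)
    nlinarith
  refine le_trans ?_ (le_sum_gammaProb (A := 2 * N * a N ^ 2) (B := 2 * N * b N ^ 2) (N := N)
    (by positivity) (by gcongr) (by linarith) ?_)
  · gcongr
  · have : b N ^ 2 ≤ 1 := pow_le_one₀ (by linarith) h3
    nlinarith

/-! ### Bernoulli laws; mean and variance of the count. -/

/-- The Bernoulli law of parameter `p` on `{0, 1} ⊆ ℝ`. -/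
noncomputable def bernoulliLaw (p : ℝ) : Measure ℝ :=
  ENNReal.ofReal (1 - p) • Measure.dirac 0 + ENNReal.ofReal p • Measure.dirac 1

section Bernoulli

variable {p : ℝ}

theorem isProbabilityMeasure_bernoulliLaw (h0 : 0 ≤ p) (h1 : p ≤ 1) :
    IsProbabilityMeasure (bernoulliLaw p) := by
  constructor
  simp only [bernoulliLaw, Measure.add_apply, Measure.smul_apply, measure_univ, smul_eq_mul,
    mul_one]
  rw [← ENNReal.ofReal_add (sub_nonneg.2 h1) h0]
  simp

theorem integral_bernoulliLaw {E : Type*} [NormedAddCommGroup E] [NormedSpace ℝ E]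
    [CompleteSpace E] (h0 : 0 ≤ p) (h1 : p ≤ 1) (f : ℝ → E) :
    ∫ x, f x ∂(bernoulliLaw p) = (1 - p) • f 0 + p • f 1 := by
  have i : ∀ x, Integrable f (Measure.dirac x) := fun x => integrable_dirac (by simp)
  rw [bernoulliLaw, integral_add_measure ((i 0).smul_measure ENNReal.ofReal_ne_top)
    ((i 1).smul_measure ENNReal.ofReal_ne_top), integral_smul_measure, integral_smul_measure,
    integral_dirac, integral_dirac, ENNReal.toReal_ofReal h0,
    ENNReal.toReal_ofReal (sub_nonneg.2 h1)]

theorem charFun_bernoulliLaw (h0 : 0 ≤ p) (h1 : p ≤ 1) (t : ℝ) :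
    charFun (bernoulliLaw p) t = 1 + (Complex.exp (t * Complex.I) - 1) * p := by
  rw [charFun_apply_real, integral_bernoulliLaw h0 h1]
  simp
  ring

theorem memLp_id_bernoulliLaw (q : ENNReal) : MemLp id q (bernoulliLaw p) := by
  have : IsFiniteMeasure (bernoulliLaw p) := ⟨by simp [bernoulliLaw]⟩
  refine MemLp.of_bound aestronglyMeasurable_id 1 ?_
  rw [bernoulliLaw, ae_add_measure_iff]
  exact ⟨Measure.ae_smul_measure (by simp [ae_dirac_eq]) _,
    Measure.ae_smul_measure (by simp [ae_dirac_eq]) _⟩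

theorem variance_bernoulliLaw (h0 : 0 ≤ p) (h1 : p ≤ 1) :
    variance id (bernoulliLaw p) = p * (1 - p) := by
  have := isProbabilityMeasure_bernoulliLaw h0 h1
  rw [variance_eq_sub (memLp_id_bernoulliLaw 2), integral_bernoulliLaw h0 h1,
    integral_bernoulliLaw h0 h1]
  simp
  ring

end Bernoulli

section RadialCount

variable {N : ℕ} {a b : ℝ}

/-- The radial count is distributed as a sum of independent Bernoulli variables. -/
theorem map_radialCount (hN : 0 < N) (ha : 0 ≤ a) (hb : 0 ≤ b) :
    (law N).map (radialCount a b) =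
      (Measure.pi fun j : Fin N => bernoulliLaw (bernoulliParam N a b j)).map
        fun x => ∑ j, x j := by
  have := fun j : Fin N => isProbabilityMeasure_bernoulliLaw (bernoulliParam_nonneg N a b j)
    (bernoulliParam_le_one N a b j)
  have := Measure.isProbabilityMeasure_map (μ := law N)
    (measurable_radialCount N a b).aemeasurable
  refine Measure.ext_of_charFun (funext fun t => ?_)
  rw [charFun_radialCount hN ha hb, charFun_map_sum_pi_eq_prod, Finset.prod_apply]
  refine Finset.prod_congr rfl fun j _ => ?_
  rw [charFun_bernoulliLaw (bernoulliParam_nonneg N a b j) (bernoulliParam_le_one N a b j)]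

theorem integral_radialCount (hN : 0 < N) (ha : 0 ≤ a) (hb : 0 ≤ b) :
    ∫ z, radialCount a b z ∂(law N) = ∑ j : Fin N, bernoulliParam N a b j := by
  have := fun j : Fin N => isProbabilityMeasure_bernoulliLaw (bernoulliParam_nonneg N a b j)
    (bernoulliParam_le_one N a b j)
  have h1 : ∫ z, radialCount a b z ∂(law N) = ∫ x, x ∂((law N).map (radialCount a b)) :=
    (integral_map (f := fun x => x) (measurable_radialCount N a b).aemeasurable
      (by fun_prop)).symm
  rw [h1, map_radialCount hN ha hb, integral_map (by fun_prop) (by fun_prop), integral_finsetSum]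
  · refine Finset.sum_congr rfl fun j _ => ?_
    have h2 := integral_comp_eval (μ := fun j : Fin N => bernoulliLaw (bernoulliParam N a b j))
      (i := j) (f := fun x : ℝ => x) aestronglyMeasurable_id
    rw [h2, integral_bernoulliLaw (bernoulliParam_nonneg N a b j) (bernoulliParam_le_one N a b j)]
    simp
  · intro j _
    exact (measurePreserving_eval (fun j : Fin N => bernoulliLaw (bernoulliParam N a b j))
      j).integrable_comp_of_integrable ((memLp_id_bernoulliLaw 1).integrable le_rfl)

theorem variance_radialCount (hN : 0 < N) (ha : 0 ≤ a) (hb : 0 ≤ b) :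
    variance (radialCount a b) (law N) =
      ∑ j : Fin N, bernoulliParam N a b j * (1 - bernoulliParam N a b j) := by
  have := fun j : Fin N => isProbabilityMeasure_bernoulliLaw (bernoulliParam_nonneg N a b j)
    (bernoulliParam_le_one N a b j)
  have h1 : variance (radialCount a b) (law N) = variance id ((law N).map (radialCount a b)) :=
    (variance_id_map (measurable_radialCount N a b).aemeasurable).symm
  have h2 := variance_sum_pi (μ := fun j : Fin N => bernoulliLaw (bernoulliParam N a b j))
    (X := fun _ => id) fun _ => memLp_id_bernoulliLaw 2
  rw [h1, map_radialCount hN ha hb, variance_id_map (by fun_prop)]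
  have h3 : (∑ j : Fin N, fun x : Fin N → ℝ => id (x j)) = fun x => ∑ j, x j := by
    ext x
    simp
  rw [h3] at h2
  rw [h2]
  exact Finset.sum_congr rfl fun j _ => variance_bernoulliLaw
    (bernoulliParam_nonneg N a b j) (bernoulliParam_le_one N a b j)

end RadialCount

/-! ### Quantitative central limit estimate for Bernoulli sums. -/

section CentralLimit

/-- Telescoping: exchange one factor at a time, all other factors lying in the unit disc. -/
theorem norm_prod_sub_prod_le {ι : Type*} (s : Finset ι) (f g : ι → ℂ) (hf : ∀ i, ‖f i‖ ≤ 1)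
    (hg : ∀ i, ‖g i‖ ≤ 1) : ‖∏ i ∈ s, f i - ∏ i ∈ s, g i‖ ≤ ∑ i ∈ s, ‖f i - g i‖ := by
  classical
  induction s using Finset.induction_on with
  | empty => simp
  | insert i s hi ih =>
    rw [Finset.prod_insert hi, Finset.prod_insert hi, Finset.sum_insert hi]
    have h : ‖∏ i ∈ s, f i‖ ≤ 1 := by
      rw [norm_prod]
      exact Finset.prod_le_one (fun _ _ => norm_nonneg _) fun i _ => hf i
    calc ‖f i * ∏ j ∈ s, f j - g i * ∏ j ∈ s, g j‖
        = ‖(f i - g i) * ∏ j ∈ s, f j + g i * (∏ j ∈ s, f j - ∏ j ∈ s, g j)‖ := by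
          congr 1; ring
      _ ≤ ‖f i - g i‖ * ‖∏ j ∈ s, f j‖ + ‖g i‖ * ‖∏ j ∈ s, f j - ∏ j ∈ s, g j‖ := by
          refine (norm_add_le _ _).trans ?_
          rw [norm_mul, norm_mul]
      _ ≤ ‖f i - g i‖ * 1 + 1 * ∑ j ∈ s, ‖f j - g j‖ := by
          gcongr
          exact hg i
      _ = _ := by ring

theorem norm_exp_mul_I_sub_le {x : ℝ} (hx : |x| ≤ 1) :
    ‖Complex.exp (x * Complex.I) - (1 + x * Complex.I - x ^ 2 / 2)‖ ≤ |x| ^ 3 := by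
  have hn : ‖(x : ℂ) * Complex.I‖ = |x| := by simp
  have h := Complex.exp_bound (x := x * Complex.I) (by rwa [hn]) (n := 3) (by norm_num)
  rw [hn] at h
  have e : ∑ m ∈ Finset.range 3, ((x : ℂ) * Complex.I) ^ m / m.factorial =
      1 + x * Complex.I - x ^ 2 / 2 := by
    simp [Finset.sum_range_succ, mul_pow]
    ring
  rw [e] at h
  refine h.trans ?_
  have : 0 ≤ |x| ^ 3 := by positivity
  norm_num [Nat.factorial]
  linarith

/-- The characteristic function of a centred Bernoulli variable. -/
noncomputable def centredBernoulliCharFun (p θ : ℝ) : ℂ :=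
  Complex.exp ((-(θ * p) : ℝ) * Complex.I) * (1 + (Complex.exp (θ * Complex.I) - 1) * p)

theorem centredBernoulliCharFun_eq (p θ : ℝ) :
    centredBernoulliCharFun p θ = (1 - p) * Complex.exp ((-(θ * p) : ℝ) * Complex.I) +
      p * Complex.exp ((θ * (1 - p) : ℝ) * Complex.I) := by
  have : Complex.exp ((θ * (1 - p) : ℝ) * Complex.I) =
      Complex.exp ((-(θ * p) : ℝ) * Complex.I) * Complex.exp (θ * Complex.I) := by
    rw [← Complex.exp_add]
    congr 1
    push_cast
    ring
  rw [centredBernoulliCharFun, this]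
  ring

variable {p θ : ℝ}

theorem norm_centredBernoulliCharFun_le (h0 : 0 ≤ p) (h1 : p ≤ 1) :
    ‖centredBernoulliCharFun p θ‖ ≤ 1 := by
  rw [centredBernoulliCharFun_eq]
  refine (norm_add_le _ _).trans (le_of_eq ?_)
  rw [norm_mul, norm_mul, Complex.norm_exp_ofReal_mul_I, Complex.norm_exp_ofReal_mul_I,
    ← Complex.ofReal_one, ← Complex.ofReal_sub, Complex.norm_real, Complex.norm_real,
    Real.norm_of_nonneg h0, Real.norm_of_nonneg (sub_nonneg.2 h1)]
  ring

/-- Both terms agree with `1 - p (1 - p) θ² / 2` to second order, the linear terms cancelling by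
centring. Keeping the factor `p (1 - p)` in the error is essential: summed over the variables it
gives the variance, not their number. -/
theorem norm_centredBernoulliCharFun_sub_exp_le (h0 : 0 ≤ p) (h1 : p ≤ 1) (hθ : |θ| ≤ 1) :
    ‖centredBernoulliCharFun p θ - (Real.exp (-(p * (1 - p) * θ ^ 2 / 2)) : ℂ)‖ ≤
      2 * (p * (1 - p)) * |θ| ^ 3 := by
  have h1' : 0 ≤ 1 - p := sub_nonneg.2 h1
  set v := p * (1 - p) with hv
  have hv0 : 0 ≤ v := mul_nonneg h0 h1'
  have hv1 : v ≤ 1 := by nlinarith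
  have ha : |(-(θ * p))| = |θ| * p := by rw [abs_neg, abs_mul, abs_of_nonneg h0]
  have hb : |θ * (1 - p)| = |θ| * (1 - p) := by rw [abs_mul, abs_of_nonneg h1']
  have hθ0 := abs_nonneg θ
  have ea := norm_exp_mul_I_sub_le (x := -(θ * p)) (by rw [ha]; nlinarith)
  have eb := norm_exp_mul_I_sub_le (x := θ * (1 - p)) (by rw [hb]; nlinarith)
  rw [ha] at ea
  rw [hb] at eb
  have hsq : θ ^ 2 = |θ| ^ 2 := (sq_abs θ).symm
  have hu0 : 0 ≤ v * θ ^ 2 / 2 := by positivity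
  have hu1 : v * θ ^ 2 / 2 ≤ 1 := by
    have : θ ^ 2 ≤ 1 := by rw [hsq]; exact pow_le_one₀ hθ0 hθ
    nlinarith
  have ec : ‖((1 - v * θ ^ 2 / 2 : ℝ) : ℂ) - (Real.exp (-(v * θ ^ 2 / 2)) : ℂ)‖ ≤
      v * |θ| ^ 3 := by
    rw [← Complex.ofReal_sub, Complex.norm_real, Real.norm_eq_abs, abs_sub_comm]
    have h := Real.exp_bound (x := -(v * θ ^ 2 / 2)) (by rwa [abs_neg, abs_of_nonneg hu0])
      (n := 2) (by norm_num)
    have e : ∑ m ∈ Finset.range 2, (-(v * θ ^ 2 / 2)) ^ m / m.factorial =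
        1 - v * θ ^ 2 / 2 := by
      simp [Finset.sum_range_succ]
      ring
    rw [e, abs_neg, abs_of_nonneg hu0] at h
    refine h.trans ?_
    norm_num [Nat.factorial]
    -- The error of order `v² θ⁴` is reduced to `v |θ|³` by discarding a factor `v |θ|`.
    have h3 : v * |θ| ≤ 1 := by nlinarith
    have h4 : 0 ≤ v * |θ| ^ 3 := by positivity
    have h5 : (v * θ ^ 2 / 2) ^ 2 = v * |θ| ^ 3 * (v * |θ|) / 4 := by rw [hsq]; ring
    rw [h5]
    nlinarith
  have ed : ‖centredBernoulliCharFun p θ - ((1 - v * θ ^ 2 / 2 : ℝ) : ℂ)‖ ≤ v * |θ| ^ 3 := by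
    have e : centredBernoulliCharFun p θ - ((1 - v * θ ^ 2 / 2 : ℝ) : ℂ) =
        ((1 - p : ℝ) : ℂ) * (Complex.exp ((-(θ * p) : ℝ) * Complex.I) -
          (1 + (-(θ * p) : ℝ) * Complex.I - (-(θ * p) : ℝ) ^ 2 / 2)) +
        (p : ℂ) * (Complex.exp ((θ * (1 - p) : ℝ) * Complex.I) -
          (1 + (θ * (1 - p) : ℝ) * Complex.I - (θ * (1 - p) : ℝ) ^ 2 / 2)) := by
      rw [centredBernoulliCharFun_eq, hv]
      push_cast
      ring
    rw [e]
    refine (norm_add_le _ _).trans ?_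
    rw [norm_mul, norm_mul, Complex.norm_real, Complex.norm_real, Real.norm_of_nonneg h0,
      Real.norm_of_nonneg h1']
    calc _ ≤ (1 - p) * (|θ| * p) ^ 3 + p * (|θ| * (1 - p)) ^ 3 := by gcongr
      _ = v * |θ| ^ 3 * (p ^ 2 + (1 - p) ^ 2) := by rw [hv]; ring
      _ ≤ v * |θ| ^ 3 * 1 := by
          gcongr
          nlinarith
      _ = _ := mul_one _
  calc _ ≤ _ := norm_sub_le_norm_sub_add_norm_sub _ ((1 - v * θ ^ 2 / 2 : ℝ) : ℂ) _
    _ ≤ v * |θ| ^ 3 + v * |θ| ^ 3 := add_le_add ed ec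
    _ = _ := by ring

theorem norm_prod_centredBernoulliCharFun_sub_le {ι : Type*} [Fintype ι] (p : ι → ℝ)
    (h0 : ∀ i, 0 ≤ p i) (h1 : ∀ i, p i ≤ 1) (hθ : |θ| ≤ 1) :
    ‖∏ i, centredBernoulliCharFun (p i) θ -
      (Real.exp (-((∑ i, p i * (1 - p i)) * θ ^ 2 / 2)) : ℂ)‖ ≤
      2 * (∑ i, p i * (1 - p i)) * |θ| ^ 3 := by
  have e : (Real.exp (-((∑ i, p i * (1 - p i)) * θ ^ 2 / 2)) : ℂ) =
      ∏ i, (Real.exp (-(p i * (1 - p i) * θ ^ 2 / 2)) : ℂ) := by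
    rw [← Complex.ofReal_prod, ← Real.exp_sum, Finset.sum_neg_distrib, ← Finset.sum_div,
      ← Finset.sum_mul]
  rw [e]
  refine (norm_prod_sub_prod_le _ _ _
    (fun i => norm_centredBernoulliCharFun_le (h0 i) (h1 i)) fun i => ?_).trans ?_
  · rw [Complex.norm_real, Real.norm_of_nonneg (Real.exp_pos _).le, Real.exp_le_one_iff,
      neg_nonpos]
    have := mul_nonneg (h0 i) (sub_nonneg.2 (h1 i))
    positivity
  · rw [Finset.mul_sum, Finset.sum_mul]
    exact Finset.sum_le_sum fun i _ => norm_centredBernoulliCharFun_sub_exp_le (h0 i) (h1 i) hθ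

end CentralLimit

theorem measurable_normalizedRadialCount (N : ℕ) (a b : ℝ) :
    Measurable (normalizedRadialCount N a b) :=
  ((measurable_radialCount N a b).sub_const _).div_const _

/-- Subtracting the mean `∑ p_j` distributes a phase `exp (-i θ p_j)` to each Bernoulli factor. For
zero variance, division by zero gives `0` and both sides are `1`. -/
theorem charFun_normalizedRadialCount {N : ℕ} (hN : 0 < N) {a b : ℝ} (ha : 0 ≤ a) (hb : 0 ≤ b)
    (t : ℝ) :
    charFun ((law N).map (normalizedRadialCount N a b)) t =
      ∏ j : Fin N, centredBernoulliCharFun (bernoulliParam N a b j)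
        (t / √(variance (radialCount a b) (law N))) := by
  set σ := √(variance (radialCount a b) (law N)) with hσ
  have h := charFun_radialCount hN ha hb (t / σ)
  rw [charFun_apply_real, integral_map (measurable_radialCount N a b).aemeasurable
    (by fun_prop)] at h
  unfold centredBernoulliCharFun
  rw [Finset.prod_mul_distrib, ← h, ← Complex.exp_sum, ← Finset.sum_mul, ← Complex.ofReal_sum,
    Finset.sum_neg_distrib, ← Finset.mul_sum, ← integral_radialCount hN ha hb,
    ← integral_const_mul, charFun_apply_real,
    integral_map (measurable_normalizedRadialCount N a b).aemeasurable (by fun_prop)]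
  congr 1 with z
  rw [← Complex.exp_add]
  congr 1
  unfold normalizedRadialCount
  rw [← hσ]
  push_cast
  ring

end QuaternionGinibre

/-! ### Convergence of the characteristic functions. -/

theorem theorem8 (a b : ℕ → ℝ) (ε : ℝ) (hε : 0 < ε)
    (ha : ∀ᶠ N in atTop, 0 ≤ a N) (hbε : ∀ᶠ N in atTop, ε ≤ b N)
    (hb : ∀ᶠ N in atTop, b N ≤ 1)
    (hab : Tendsto (fun N : ℕ => (N : ℝ) * (b N - a N)) atTop atTop) :
    TendstoInDistribution
      (fun N : ℕ => QuaternionGinibre.normalizedRadialCount N (a N) (b N))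
      atTop (id : ℝ → ℝ) (fun N : ℕ => QuaternionGinibre.law N) (gaussianReal 0 1) where
  forall_aemeasurable N :=
    (QuaternionGinibre.measurable_normalizedRadialCount N (a N) (b N)).aemeasurable
  tendsto := by
    refine ProbabilityMeasure.tendsto_iff_tendsto_charFun.2 fun t => ?_
    simp only [ProbabilityMeasure.coe_mk, Measure.map_id, charFun_gaussianReal]
    set V : ℕ → ℝ := fun N => ∑ j : Fin N, QuaternionGinibre.bernoulliParam N (a N) (b N) j *
      (1 - QuaternionGinibre.bernoulliParam N (a N) (b N) j) with hV
    have hVtop : Tendsto V atTop atTop :=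
      QuaternionGinibre.tendsto_sum_bernoulliParam a b ε hε ha hbε hb hab
    have hlim : Tendsto (fun N => 2 * |t| ^ 3 / √(V N)) atTop (𝓝 0) :=
      (Real.tendsto_sqrt_atTop.comp hVtop).const_div_atTop _
    rw [tendsto_iff_norm_sub_tendsto_zero]
    refine squeeze_zero' (Eventually.of_forall fun _ => norm_nonneg _) ?_ hlim
    -- The condition `t ^ 2 ≤ V N` is what gives `|θ| ≤ 1` for `θ = t / √(V N)`.
    filter_upwards [ha, hbε, eventually_gt_atTop 0, hVtop.eventually_ge_atTop (t ^ 2),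
      hVtop.eventually_gt_atTop 0] with N h1 h2 h3 h4 h5
    have hs : 0 < √(V N) := Real.sqrt_pos.2 h5
    have hsq : √(V N) ^ 2 = V N := Real.sq_sqrt h5.le
    have hb0 : 0 ≤ b N := hε.le.trans h2
    rw [QuaternionGinibre.charFun_normalizedRadialCount h3 h1 hb0,
      QuaternionGinibre.variance_radialCount h3 h1 hb0]
    have habs : |t / √(V N)| = |t| / √(V N) := by rw [abs_div, abs_of_pos hs]
    have key := QuaternionGinibre.norm_prod_centredBernoulliCharFun_sub_le
      (θ := t / √(V N)) (fun j : Fin N => QuaternionGinibre.bernoulliParam N (a N) (b N) j)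
      (fun j => QuaternionGinibre.bernoulliParam_nonneg _ _ _ _)
      (fun j => QuaternionGinibre.bernoulliParam_le_one _ _ _ _)
      (by rw [habs, div_le_one hs]; exact Real.le_sqrt_of_sq_le (by rwa [sq_abs]))
    have e1 : V N * (t / √(V N)) ^ 2 / 2 = t ^ 2 / 2 := by
      rw [div_pow, hsq]
      field_simp
    have e2 : 2 * V N * |t / √(V N)| ^ 3 = 2 * |t| ^ 3 / √(V N) := by
      rw [habs, div_pow]
      nth_rewrite 1 [← hsq]
      field_simp
    change ‖_ - (Real.exp (-(V N * (t / √(V N)) ^ 2 / 2)) : ℂ)‖ ≤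
      2 * V N * |t / √(V N)| ^ 3 at key
    rw [e1, e2] at key
    convert key using 4
    congr 1
    simp
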